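/- Let $N=2^n$ with $n\ge 1$, and identify the index set $[N]$ with $\{0,1\}^n$. The Simon property is $$\mathcal{P}_{Simon}=\{x\in[N]^N : \exists s\in\{0,1\}^n\setminus\{0^n\}\text{ such that } x_i=x_j \text{ whenever } j=i\oplus s\}.$$ With the normalized Hamming distance $d(x,y)=|\{i:x_i\ne y_i\}|/N$, an input $x\in[N]^N$ is called $\frac14$-far from $\mathcal{P}_{Simon}$ if $d(x,y)\ge \frac14$ for all $y\in\mathcal{P}_{Simon}$. A $\frac14$-property tester is a query algorithm that accepts every $x\in\mathcal{P}_{Simon}$ with probability at least $2/3$ and rejects every $x$ that is $\frac14$-far from $\mathcal{P}_{Simon}$ with probability at least $2/3$. A $T$-query quantum algorithm prepares $U_TO_xU_{T-1}O_x\cdots O_xU_0|0\cdots0\rangle$, where the unitaries $U_0,\dots,U_T$ do not depend on $x$, $O_x:|i\rangle|b\rangle\mapsto|i\rangle|b+x_i \bmod N\rangle$ acts as the identity on a finite workspace of qubits, and measures the result to determine its output. A $T$-query classical algorithm is a probability distribution over deterministic adaptive decision trees that make at most $T$ queries $i\mapsto x_i$. Then there is a quantum $\frac14$-property tester for the Simon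 property using $O(\log N)$ queries, while every classical $\frac14$-property tester for it needs $\Omega(\sqrt N)$ queries. That is, there are absolute constants $C,c>0$ such that for every $n\ge1$ and $N=2^n$: some quantum $\frac14$-property tester for $\mathcal{P}_{Simon}$ makes at most $C\log_2 N$ queries, and every classical (randomized) $\frac14$-property tester for $\mathcal{P}_{Simon}$ that makes at most $T$ queries satisfies $T\ge c\sqrt N$. -/

import Mathlib

/-! ### Property testing for strings

A string of length `N` over an alphabet of size `m` is a function `x : I → ZMod m`, where `I` is
an index set with `N` elements; the alphabet `[m]` is identified with the residues mod `m`. -/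

/-- Normalized Hamming distance `d(x,y) = |{i : x_i ≠ y_i}| / N`. -/
noncomputable def normHammingDist {I A : Type} [Fintype I] [DecidableEq A] (x y : I → A) : ℝ :=
  (hammingDist x y : ℝ) / (Fintype.card I : ℝ)

/-- `x` is `ε`-far from the property `P`: `d(x,y) ≥ ε` for all `y ∈ P`. -/
def IsFar {I A : Type} [Fintype I] [DecidableEq A] (ε : ℝ) (P : Set (I → A)) (x : I → A) : Prop :=
  ∀ y ∈ P, ε ≤ normHammingDist x y

/-- `pr x b` is the probability that an algorithm outputs `b` on input `x` (`true` is "accept",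
`false` is "reject").  The algorithm is an `ε`-property tester for `P` if it accepts every `x ∈ P`
with probability at least `2/3` and rejects every `x` that is `ε`-far from `P` with probability
at least `2/3`. -/
def IsPropertyTester {I A : Type} [Fintype I] [DecidableEq A] (ε : ℝ) (P : Set (I → A))
    (pr : (I → A) → Bool → ℝ) : Prop :=
  (∀ x ∈ P, 2 / 3 ≤ pr x true) ∧ (∀ x, IsFar ε P x → 2 / 3 ≤ pr x false)

/-! ### Classical query algorithms -/

/-- A deterministic (adaptive) classical query algorithm: either stop with an output, or query
the input at an index `i` and continue depending on the answer `x i`. -/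
inductive DecisionTree (I A : Type) : Type
  | leaf (output : Bool) : DecisionTree I A
  | query (i : I) (next : A → DecisionTree I A) : DecisionTree I A

/-- The output on input `x`. -/
def DecisionTree.eval {I A : Type} (x : I → A) : DecisionTree I A → Bool
  | .leaf b => b
  | .query i next => (next (x i)).eval x

/-- The worst-case number of queries. -/
def DecisionTree.depth {I A : Type} [Fintype A] : DecisionTree I A → ℕ
  | .leaf _ => 0
  | .query _ next => 1 + Finset.univ.sup (fun a => (next a).depth)

/-- A classical (randomized) query algorithm making at most `queries` queries:
a probability distribution over decision trees of depth at most `queries`. -/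
structure ClassicalQueryAlgorithm (I A : Type) [Fintype A] where
  /-- the bound on the number of queries -/
  queries : ℕ
  /-- the distribution of the decision tree that is run -/
  tree : PMF (DecisionTree I A)
  depth_le : ∀ t ∈ tree.support, t.depth ≤ queries

/-- The probability that the algorithm outputs `b` on input `x`. -/
noncomputable def ClassicalQueryAlgorithm.outputProb {I A : Type} [Fintype A]
    (R : ClassicalQueryAlgorithm I A) (x : I → A) (b : Bool) : ℝ :=
  ((R.tree.map (DecisionTree.eval x)) b).toReal

/-! ### Quantum query algorithms -/

/-- Labels `(i, b, v)` of the computational basis states `|i⟩|b⟩|v⟩`: an index register, an answer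
register of dimension `m`, and a workspace of `w` qubits. -/
abbrev QBasis (I : Type) (m w : ℕ) : Type := I × ZMod m × (Fin w → Bool)

/-- The query `O_x : |i⟩|b⟩|v⟩ ↦ |i⟩|b + x_i⟩|v⟩` (addition mod `m`), extended linearly to
amplitude vectors: the new amplitude of `(i, b, v)` is the old amplitude of `(i, b - x_i, v)`. -/
def quantumQuery {I : Type} {m w : ℕ} (x : I → ZMod m) (ψ : QBasis I m w → ℂ) :
    QBasis I m w → ℂ :=
  fun z => ψ (z.1, z.2.1 - x z.1, z.2.2)

theorem quantumQuery_basis {I : Type} {m w : ℕ} [DecidableEq I] (x : I → ZMod m)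
    (i : I) (b : ZMod m) (v : Fin w → Bool) :
    quantumQuery x (Pi.single (i, b, v) 1) = Pi.single (i, b + x i, v) 1 := by
  funext ⟨j, c, u⟩
  by_cases h : j = i
  · subst h
    simp [quantumQuery, Pi.single_apply, sub_eq_iff_eq_add]
  · simp [quantumQuery, h]

/-- A quantum query algorithm making `queries = T` queries: fixed unitaries `U 0, …, U T` (the
later entries of the sequence `U` are never used), which do not depend on the input, and a
classical output computed from the result of measuring the final state in the computational
basis. -/
structure QuantumQueryAlgorithm (I : Type) [Fintype I] [DecidableEq I] (m : ℕ) [NeZero m] where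
  /-- the number of queries -/
  queries : ℕ
  /-- the number of workspace qubits -/
  w : ℕ
  /-- the unitaries applied between the queries -/
  U : ℕ → Matrix.unitaryGroup (QBasis I m w) ℂ
  /-- the output, as a function of the measurement outcome -/
  output : QBasis I m w → Bool

/-- The state `U_t O_x U_{t-1} O_x ⋯ O_x U_0 |0⟩|0⟩|0^w⟩`. -/
noncomputable def QuantumQueryAlgorithm.state {I : Type} [Fintype I] [DecidableEq I] [Zero I]
    {m : ℕ} [NeZero m] (Q : QuantumQueryAlgorithm I m) (x : I → ZMod m) :
    ℕ → (QBasis I m Q.w → ℂ)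
  | 0 => Matrix.mulVec (Q.U 0).val (Pi.single (0, 0, fun _ => false) 1)
  | t + 1 => Matrix.mulVec (Q.U (t + 1)).val (quantumQuery x (Q.state x t))

/-- The probability that measuring the final state yields output `b` on input `x`. -/
noncomputable def QuantumQueryAlgorithm.outputProb {I : Type} [Fintype I] [DecidableEq I] [Zero I]
    {m : ℕ} [NeZero m] (Q : QuantumQueryAlgorithm I m) (x : I → ZMod m) (b : Bool) : ℝ :=
  ∑ z with Q.output z = b, ‖Q.state x Q.queries z‖ ^ 2

/-! ### The Simon property -/

/-- `{0,1}^n`, with bitwise addition mod 2 as `+` and the all-zero string as `0`. It has `2^n`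
elements and serves as the index set `[N]`, `N = 2^n`. -/
abbrev BitString (n : ℕ) : Type := Fin n → ZMod 2

/-- The strings `x ∈ [N]^N`, `N = 2^n`, for which there is a nonzero `s ∈ {0,1}^n` such that
`x_i = x_j` whenever `j = i ⊕ s`. -/
def simonProperty (n : ℕ) : Set (BitString n → ZMod (2 ^ n)) :=
  {x | ∃ s : BitString n, s ≠ 0 ∧ ∀ i j, j = i + s → x i = x j}

/-! ### Bit strings -/

/-! Lower bound: compare a uniformly random bijection `π` with its folded versions `π ∘ foldAlong s
k`. The former is far from the property (`isFar_simonProperty_of_injective`), the latter lie in it.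
A tree with `T` queries can tell them apart only if two queried indices differ by `s`, which for a
given `π` happens for at most `T²` shifts `s`. This is made exact by an injection between bijections
(`card_eval_equiv_le`), then averaged over all `s`: `(N-1)·2/3 ≤ (N-1)/3 + T²`.

Upper bound: a Simon sample is orthogonal to `s` with probability `(1+q)/2`, where `q` is the
fraction of `i` with `x i = x (i + s)` (`sum_simonAmplitude_sq_mul`). A period of `x` gives `q = 1`;
for far `x` every nonzero `s` has `q ≤ 1/2` (`card_eq_shift_le_of_isFar`). A union bound over `s`
shows that `7n` samples suffice. Sampling is done coherently, storing each sample in a fresh slot,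
and `simonState_apply` is the invariant of that circuit. -/

theorem bitString_add_add_self {n : ℕ} (i s : BitString n) : i + s + s = i := by
  ext k
  simp [add_assoc, CharTwo.add_self_eq_zero]

theorem bitString_add_eq_zero_iff {n : ℕ} (i j : BitString n) : i + j = 0 ↔ i = j := by
  constructor
  · intro h
    rw [← bitString_add_add_self i j, h, zero_add]
  · rintro rfl
    simpa using bitString_add_add_self 0 i

theorem card_bitString (n : ℕ) : Fintype.card (BitString n) = 2 ^ n := by
  simp [BitString]

theorem exists_coord_ne_zero {n : ℕ} {s : BitString n} (hs : s ≠ 0) : ∃ k, s k ≠ 0 :=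
  Function.ne_iff.mp hs

/-- The representative of the coset `{i, i + s}` whose `k`-th coordinate is `0`
(provided `s k ≠ 0`). -/
def foldAlong {n : ℕ} (s : BitString n) (k : Fin n) (i : BitString n) : BitString n :=
  if i k = 0 then i else i + s

theorem foldAlong_add {n : ℕ} {s : BitString n} {k : Fin n} (hk : s k ≠ 0) (i : BitString n) :
    foldAlong s k (i + s) = foldAlong s k i := by
  have h1 : ∀ a b : ZMod 2, b ≠ 0 → (a + b = 0 ↔ a ≠ 0) := by decide
  by_cases h : i k = 0
  · have : ¬ (i + s) k = 0 := by simp [h, hk]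
    rw [foldAlong, foldAlong, if_neg this, if_pos h, bitString_add_add_self]
  · have : (i + s) k = 0 := (h1 _ _ hk).2 h
    rw [foldAlong, foldAlong, if_pos this, if_neg h]

theorem comp_foldAlong_mem_simonProperty {n : ℕ} {s : BitString n} {k : Fin n} (hk : s k ≠ 0)
    (x : BitString n → ZMod (2 ^ n)) : x ∘ foldAlong s k ∈ simonProperty n := by
  refine ⟨s, fun h => hk (by simp [h]), ?_⟩
  rintro i j rfl
  simp [foldAlong_add hk]

/-- The involution exchanging `i` and `i + s` whenever the one of them with nonzero `k`-th
coordinate lies in `D`. -/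
def flipOn {n : ℕ} (s : BitString n) (k : Fin n) (D : Finset (BitString n)) :
    Equiv.Perm (BitString n) :=
  Function.Involutive.toPerm
    (fun i => if (i ∈ D ∧ i k ≠ 0) ∨ (i + s ∈ D ∧ (i + s) k ≠ 0) then i + s else i) (by
      intro i
      by_cases h : (i ∈ D ∧ i k ≠ 0) ∨ (i + s ∈ D ∧ (i + s) k ≠ 0)
      · simp only [if_pos h]
        rw [bitString_add_add_self, if_pos h.symm]
      · simp only [if_neg h])

theorem flipOn_apply {n : ℕ} (s : BitString n) (k : Fin n) (D : Finset (BitString n))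
    (i : BitString n) :
    flipOn s k D i = if (i ∈ D ∧ i k ≠ 0) ∨ (i + s ∈ D ∧ (i + s) k ≠ 0) then i + s else i :=
  rfl

/-- Folding moves a queried `i` with `i k ≠ 0` to its partner, and the flip moves it back. Since the
partner is not in `D`, the two choices never conflict. -/
theorem flipOn_foldAlong {n : ℕ} (s : BitString n) (k : Fin n) {D : Finset (BitString n)}
    {i : BitString n} (hi : i ∈ D) (his : i + s ∉ D) :
    flipOn s k D (foldAlong s k i) = i := by
  by_cases h : i k = 0
  · rw [foldAlong, if_pos h, flipOn_apply, if_neg (by simp [h, his])]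
  · rw [foldAlong, if_neg h, flipOn_apply, bitString_add_add_self, if_pos (Or.inr ⟨hi, h⟩)]

/-! ### Injective strings are far from the Simon property -/

/-- Agreement with a periodic `y` at both `i` and `i + s` would contradict injectivity, so the shift
by `s` injects agreements into disagreements; the distance is even at least 1/2. -/
theorem isFar_simonProperty_of_injective {n : ℕ} {x : BitString n → ZMod (2 ^ n)}
    (hx : Function.Injective x) : IsFar (1 / 4) (simonProperty n) x := by
  rintro y ⟨s, hs, hy⟩
  set E : Finset (BitString n) := {i | x i = y i}
  set F : Finset (BitString n) := {i | x i ≠ y i}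
  have hEF : E.card + F.card = 2 ^ n := by
    rw [← card_bitString n]
    exact Finset.card_filter_add_card_filter_not _
  have hle : E.card ≤ F.card := by
    refine Finset.card_le_card_of_injOn (· + s) ?_ (fun a _ b _ h => add_right_cancel h)
    intro i hi
    have hi' : x i = y i := by simpa [E] using hi
    simp only [F, Finset.coe_filter, Finset.mem_univ, true_and, Set.mem_ofPred_eq]
    intro h
    have := hx (hi'.trans ((hy i _ rfl).trans h.symm))
    exact hs (by simpa using this)
  have hd : hammingDist x y = F.card := rfl
  rw [normHammingDist, hd, card_bitString, le_div_iff₀ (by positivity)]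
  have h1 : (E.card : ℝ) + F.card = 2 ^ n := by exact_mod_cast hEF
  have h2 : (E.card : ℝ) ≤ F.card := by exact_mod_cast hle
  push_cast
  have : (0 : ℝ) < 2 ^ n := by positivity
  linarith

/-! ### The lower bound for classical algorithms -/

/-- The set of indices queried by a decision tree on input `x`. -/
def DecisionTree.queried {I A : Type} [DecidableEq I] (x : I → A) : DecisionTree I A → Finset I
  | .leaf _ => ∅
  | .query i next => insert i ((next (x i)).queried x)

theorem DecisionTree.card_queried_le_depth {I A : Type} [DecidableEq I] [Fintype A] (x : I → A)
    (t : DecisionTree I A) : (t.queried x).card ≤ t.depth := by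
  induction t with
  | leaf b => simp [queried]
  | query i next ih =>
    rw [queried, depth, add_comm]
    refine (Finset.card_insert_le _ _).trans (Nat.add_le_add_right ((ih (x i)).trans ?_) 1)
    exact Finset.le_sup (f := fun a => (next a).depth) (Finset.mem_univ (x i))

theorem DecisionTree.eval_congr {I A : Type} [DecidableEq I] {x y : I → A}
    (t : DecisionTree I A) (h : ∀ i ∈ t.queried x, x i = y i) :
    t.eval x = t.eval y ∧ t.queried x = t.queried y := by
  induction t with
  | leaf b => simp [queried, eval]
  | query i next ih =>
    have hi : x i = y i := h i (by simp [queried])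
    have := ih (x i) (fun j hj => h j (by simp [queried, hj]))
    simp only [eval, queried, ← hi]
    exact ⟨this.1, by rw [this.2]⟩

/-- Sending `π` to its flip along `t.queried π` preserves the whole run of the tree, once the
flipped bijection is folded. -/
theorem DecisionTree.card_eval_equiv_le {n : ℕ} {A : Type} [Fintype A] [DecidableEq A]
    (t : DecisionTree (BitString n) A) (b : Bool) (s : BitString n) (k : Fin n) :
    Finset.card {π : BitString n ≃ A |
        t.eval π = b ∧ ∀ i ∈ t.queried π, i + s ∉ t.queried π} ≤
      Finset.card {π : BitString n ≃ A | t.eval (π ∘ foldAlong s k) = b} := by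
  have key : ∀ π : BitString n ≃ A, (∀ i ∈ t.queried π, i + s ∉ t.queried π) →
      t.eval π = t.eval (((flipOn s k (t.queried π)).trans π) ∘ foldAlong s k) ∧
      t.queried π = t.queried (((flipOn s k (t.queried π)).trans π) ∘ foldAlong s k) := by
    intro π h
    refine t.eval_congr fun i hi => ?_
    simp [flipOn_foldAlong s k hi (h i hi)]
  refine Finset.card_le_card_of_injOn (fun π => (flipOn s k (t.queried π)).trans π) ?_ ?_
  · intro π hπ
    obtain ⟨h1, h2⟩ : t.eval π = b ∧ ∀ i ∈ t.queried π, i + s ∉ t.queried π := by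
      simpa using hπ
    simpa only [Finset.coe_filter, Finset.mem_univ, true_and, Set.mem_ofPred_eq,
      ← (key π h2).1] using h1
  · intro π hπ ρ hρ h
    obtain ⟨-, h2⟩ : t.eval π = b ∧ ∀ i ∈ t.queried π, i + s ∉ t.queried π := by
      simpa using hπ
    obtain ⟨-, h4⟩ : t.eval ρ = b ∧ ∀ i ∈ t.queried ρ, i + s ∉ t.queried ρ := by
      simpa using hρ
    -- The image alone determines the queried set, hence the flip, which can then be undone.
    have hD : t.queried π = t.queried ρ := by
      rw [(key π h2).2, (key ρ h4).2]
      simp only at h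
      rw [h]
    simp only [hD] at h
    ext i
    have := Equiv.congr_fun h ((flipOn s k (t.queried ρ)).symm i)
    simpa using this

/-- Each such `s` is a sum of two elements of `D`. -/
theorem card_shifts_meeting_le {n : ℕ} (D : Finset (BitString n)) :
    Finset.card {s : {s : BitString n // s ≠ 0} | ¬ ∀ i ∈ D, i + s.1 ∉ D} ≤ D.card ^ 2 := by
  rw [sq, ← Finset.card_product, ← Finset.card_map (Function.Embedding.subtype _)]
  refine (Finset.card_le_card ?_).trans
    (Finset.card_image_le (f := fun p : BitString n × BitString n => p.1 + p.2))
  intro s hs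
  simp only [Finset.mem_map, Finset.mem_filter, Finset.mem_univ, true_and, not_forall, not_not,
    Function.Embedding.coe_subtype] at hs
  obtain ⟨a, ⟨i, hi, his⟩, rfl⟩ := hs
  refine Finset.mem_image.2 ⟨(i, i + a.1), Finset.mem_product.2 ⟨hi, his⟩, ?_⟩
  simp only
  rw [add_comm i a.1, add_comm, bitString_add_add_self]

theorem DecisionTree.card_mul_card_eval_le {n : ℕ} {A : Type} [Fintype A] [DecidableEq A]
    (t : DecisionTree (BitString n) A) (b : Bool) (T : ℕ) (hT : t.depth ≤ T)
    (k : {s : BitString n // s ≠ 0} → Fin n) :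
    Fintype.card {s : BitString n // s ≠ 0} *
        Finset.card {π : BitString n ≃ A | t.eval π = b} ≤
      (∑ s : {s : BitString n // s ≠ 0},
        Finset.card {π : BitString n ≃ A | t.eval (π ∘ foldAlong s.1 (k s)) = b}) +
      T ^ 2 * Fintype.card (BitString n ≃ A) := by
  have h1 : ∀ s : {s : BitString n // s ≠ 0},
      Finset.card {π : BitString n ≃ A | t.eval π = b} ≤
      Finset.card {π : BitString n ≃ A | t.eval (π ∘ foldAlong s.1 (k s)) = b} +
      Finset.card {π : BitString n ≃ A | ¬ ∀ i ∈ t.queried π, i + s.1 ∉ t.queried π} := by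
    intro s
    refine le_trans ?_ (Nat.add_le_add_right (t.card_eval_equiv_le b s.1 (k s)) _)
    refine le_trans (Finset.card_le_card ?_) (Finset.card_union_le _ _)
    intro π hπ
    simp only [Finset.mem_filter, Finset.mem_univ, true_and, Finset.mem_union] at hπ ⊢
    tauto
  have h2 : (∑ s : {s : BitString n // s ≠ 0},
      Finset.card {π : BitString n ≃ A | ¬ ∀ i ∈ t.queried π, i + s.1 ∉ t.queried π}) ≤
      T ^ 2 * Fintype.card (BitString n ≃ A) := by
    simp only [Finset.card_filter]
    rw [Finset.sum_comm]
    simp only [← Finset.card_filter]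
    rw [mul_comm, ← smul_eq_mul, ← Finset.card_univ]
    refine Finset.sum_le_card_nsmul _ _ _ fun π _ => ?_
    exact (card_shifts_meeting_le _).trans
      (Nat.pow_le_pow_left ((t.card_queried_le_depth _).trans hT) 2)
  calc _ = ∑ _s : {s : BitString n // s ≠ 0},
        Finset.card {π : BitString n ≃ A | t.eval π = b} := by simp
    _ ≤ _ := Finset.sum_le_sum fun s _ => h1 s
    _ = _ := Finset.sum_add_distrib
    _ ≤ _ := Nat.add_le_add_left h2 _

namespace ClassicalQueryAlgorithm

variable {I A : Type} [Fintype A]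

theorem outputProb_true_add_false (R : ClassicalQueryAlgorithm I A) (x : I → A) :
    R.outputProb x true + R.outputProb x false = 1 := by
  have h := (R.tree.map (DecisionTree.eval x)).tsum_coe
  rw [tsum_fintype, Fintype.sum_bool] at h
  rw [outputProb, outputProb, ← ENNReal.toReal_add (PMF.apply_ne_top _ _) (PMF.apply_ne_top _ _),
    h, ENNReal.toReal_one]

theorem map_eval_apply (R : ClassicalQueryAlgorithm I A) (x : I → A) (b : Bool) :
    R.tree.map (DecisionTree.eval x) b =
      ∑' t, R.tree t * (if t.eval x = b then 1 else 0) := by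
  rw [PMF.map_apply]
  refine tsum_congr fun t => ?_
  by_cases h : t.eval x = b
  · simp [h]
  · simp [h, Ne.symm h]

theorem sum_map_eval_apply {ι : Type} [Fintype ι] (R : ClassicalQueryAlgorithm I A)
    (x : ι → I → A) (b : Bool) :
    ∑ j, R.tree.map (DecisionTree.eval (x j)) b =
      ∑' t, R.tree t * (Finset.card {j | t.eval (x j) = b} : ENNReal) := by
  simp only [map_eval_apply]
  rw [← Summable.tsum_finsetSum (fun _ _ => ENNReal.summable)]
  refine tsum_congr fun t => ?_
  rw [← Finset.mul_sum, Finset.card_filter]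
  push_cast
  rfl

theorem card_mul_sum_outputProb_le {n : ℕ} [DecidableEq A]
    (R : ClassicalQueryAlgorithm (BitString n) A) (b : Bool)
    (k : {s : BitString n // s ≠ 0} → Fin n) :
    (Fintype.card {s : BitString n // s ≠ 0} : ℝ) * ∑ π : BitString n ≃ A, R.outputProb π b ≤
      (∑ s : {s : BitString n // s ≠ 0}, ∑ π : BitString n ≃ A,
        R.outputProb (π ∘ foldAlong s.1 (k s)) b) +
      (R.queries : ℝ) ^ 2 * Fintype.card (BitString n ≃ A) := by
  have key : (Fintype.card {s : BitString n // s ≠ 0} : ENNReal) *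
        ∑ π : BitString n ≃ A, R.tree.map (DecisionTree.eval π) b ≤
      (∑ s : {s : BitString n // s ≠ 0}, ∑ π : BitString n ≃ A,
        R.tree.map (DecisionTree.eval (π ∘ foldAlong s.1 (k s))) b) +
      (R.queries : ENNReal) ^ 2 * Fintype.card (BitString n ≃ A) := by
    -- The constant `T²` term is multiplied by the total mass 1 of the distribution, so that the
    -- inequality can be checked tree by tree.
    simp only [sum_map_eval_apply]
    rw [← Summable.tsum_finsetSum (fun _ _ => ENNReal.summable), ← ENNReal.tsum_mul_left,
      ← one_mul ((R.queries : ENNReal) ^ 2 * _), ← R.tree.tsum_coe, ← ENNReal.tsum_mul_right,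
      ← ENNReal.tsum_add]
    refine ENNReal.tsum_le_tsum fun t => ?_
    by_cases ht : t ∈ R.tree.support
    · rw [← Finset.mul_sum, ← mul_add, mul_left_comm]
      gcongr
      exact_mod_cast t.card_mul_card_eval_le b R.queries (R.depth_le t ht) k
    · simp [(PMF.apply_eq_zero_iff _ _).2 ht]
  have hfin : ∀ x, R.tree.map (DecisionTree.eval x) b ≠ ⊤ := fun x => PMF.apply_ne_top _ _
  have hfin2 : ∀ s : {s : BitString n // s ≠ 0}, ∑ π : BitString n ≃ A,
        R.tree.map (DecisionTree.eval (π ∘ foldAlong s.1 (k s))) b ≠ ⊤ :=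
    fun s => ENNReal.sum_ne_top.2 fun _ _ => hfin _
  have hfin3 := ENNReal.sum_ne_top (s := Finset.univ).2 fun s _ => hfin2 s
  have hfin4 : (R.queries : ENNReal) ^ 2 * Fintype.card (BitString n ≃ A) ≠ ⊤ := by
    exact_mod_cast ENNReal.natCast_ne_top (R.queries ^ 2 * Fintype.card (BitString n ≃ A))
  have := ENNReal.toReal_mono (ENNReal.add_ne_top.2 ⟨hfin3, hfin4⟩) key
  rw [ENNReal.toReal_add hfin3 hfin4, ENNReal.toReal_mul, ENNReal.toReal_mul,
    ENNReal.toReal_sum (fun _ _ => hfin _), ENNReal.toReal_sum (fun _ _ => hfin2 _)] at this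
  simp only [ENNReal.toReal_sum (fun _ _ => hfin _), ENNReal.toReal_natCast,
    ENNReal.toReal_pow] at this
  exact this

end ClassicalQueryAlgorithm

theorem sqrt_le_queries_of_isPropertyTester {n : ℕ} (hn : 1 ≤ n)
    (R : ClassicalQueryAlgorithm (BitString n) (ZMod (2 ^ n)))
    (hR : IsPropertyTester (1 / 4) (simonProperty n) R.outputProb) :
    1 / 3 * √((2 : ℝ) ^ n) ≤ R.queries := by
  choose k hk using fun s : {s : BitString n // s ≠ 0} => exists_coord_ne_zero s.2
  have h := R.card_mul_sum_outputProb_le false k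
  have hM : Fintype.card {s : BitString n // s ≠ 0} = 2 ^ n - 1 := by
    rw [Fintype.card_subtype_compl, card_bitString, Fintype.card_subtype_eq]
  have hM' : (Fintype.card {s : BitString n // s ≠ 0} : ℝ) = 2 ^ n - 1 := by
    rw [hM, Nat.cast_sub Nat.one_le_two_pow]
    simp
  have hne : Nonempty (BitString n ≃ ZMod (2 ^ n)) :=
    ⟨Fintype.equivOfCardEq (by rw [card_bitString, ZMod.card])⟩
  set F : ℝ := (Fintype.card (BitString n ≃ ZMod (2 ^ n)) : ℝ) with hFdef
  have hF : 0 < F := by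
    rw [hFdef]
    exact_mod_cast Fintype.card_pos
  have h1 : F * (2 / 3) ≤ ∑ π : BitString n ≃ ZMod (2 ^ n), R.outputProb π false := by
    rw [← nsmul_eq_mul, ← Finset.card_univ]
    exact Finset.card_nsmul_le_sum _ _ _ fun π _ =>
      hR.2 _ (isFar_simonProperty_of_injective π.injective)
  have h2 : ∀ s : {s : BitString n // s ≠ 0}, ∑ π : BitString n ≃ ZMod (2 ^ n),
      R.outputProb (π ∘ foldAlong s.1 (k s)) false ≤ F * (1 / 3) := by
    intro s
    rw [← nsmul_eq_mul, ← Finset.card_univ]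
    refine Finset.sum_le_card_nsmul _ _ _ fun π _ => ?_
    have := hR.1 _ (comp_foldAlong_mem_simonProperty (hk s) π)
    have := R.outputProb_true_add_false (π ∘ foldAlong s.1 (k s))
    linarith
  have h3 := Finset.sum_le_card_nsmul Finset.univ _ _ fun s _ => h2 s
  rw [Finset.card_univ, nsmul_eq_mul, hM'] at h3
  rw [hM'] at h
  have hN : (2 : ℝ) ≤ 2 ^ n := by
    simpa using pow_le_pow_right₀ (one_le_two : (1 : ℝ) ≤ 2) hn
  have h4 := mul_le_mul_of_nonneg_left h1 (by linarith : (0 : ℝ) ≤ 2 ^ n - 1)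
  have h5 : F * ((2 ^ n - 1) / 3) ≤ F * (R.queries : ℝ) ^ 2 := by linarith
  have h6 := le_of_mul_le_mul_left h5 hF
  have h7 : √((2 : ℝ) ^ n) ≤ 3 * R.queries := by
    refine Real.sqrt_le_iff.2 ⟨by positivity, ?_⟩
    -- `(N-1)/3 ≤ T²` and `N ≥ 2` give `N ≤ 9T²`.
    nlinarith
  linarith

/-! ### Fourier analysis on bit strings -/

/-- The character `u ↦ (-1)^u` of `ZMod 2`. -/
noncomputable def bitSign (u : ZMod 2) : ℝ := if u = 0 then 1 else -1

theorem bitSign_zero : bitSign 0 = 1 := if_pos rfl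

theorem bitSign_of_ne {u : ZMod 2} (hu : u ≠ 0) : bitSign u = -1 := if_neg hu

theorem bitSign_add (u v : ZMod 2) : bitSign (u + v) = bitSign u * bitSign v := by
  have h1 : ∀ a b : ZMod 2, a ≠ 0 → b ≠ 0 → a + b = 0 := by decide
  by_cases hu : u = 0
  · simp [hu, bitSign_zero]
  · by_cases hv : v = 0
    · simp [hv, bitSign_zero]
    · rw [h1 u v hu hv, bitSign_zero, bitSign_of_ne hu, bitSign_of_ne hv]
      norm_num

theorem sum_bitSign_dotProduct {n : ℕ} (u : BitString n) :
    ∑ z : BitString n, bitSign (z ⬝ᵥ u) = if u = 0 then (2 : ℝ) ^ n else 0 := by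
  split_ifs with hu
  · simp [hu, bitSign_zero]
  · obtain ⟨k, hk⟩ := exists_coord_ne_zero hu
    -- Flipping coordinate `k` of `z` negates every term, so the sum equals its own negative.
    have h := Equiv.sum_comp (Equiv.addRight (Pi.single k (1 : ZMod 2)))
      (fun z : BitString n => bitSign (z ⬝ᵥ u))
    simp only [Equiv.coe_addRight, add_dotProduct, bitSign_add, single_dotProduct, one_mul,
      bitSign_of_ne hk, ← Finset.sum_mul] at h
    linarith

/-- The real Walsh–Hadamard coefficients `(-1)^(i·j) / √N`. -/
noncomputable def hadamardCoeff {n : ℕ} (i j : BitString n) : ℝ :=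
  bitSign (i ⬝ᵥ j) / √((2 : ℝ) ^ n)

theorem hadamardCoeff_comm {n : ℕ} (i j : BitString n) :
    hadamardCoeff i j = hadamardCoeff j i := by
  rw [hadamardCoeff, hadamardCoeff, dotProduct_comm]

theorem hadamardCoeff_zero_right {n : ℕ} (i : BitString n) :
    hadamardCoeff i 0 = 1 / √((2 : ℝ) ^ n) := by
  simp [hadamardCoeff, bitSign_zero]

theorem sum_hadamardCoeff_mul {n : ℕ} (i j : BitString n) :
    ∑ z, hadamardCoeff i z * hadamardCoeff z j = if i = j then 1 else 0 := by
  have hN : (0 : ℝ) < 2 ^ n := by positivity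
  have h : ∀ z, hadamardCoeff i z * hadamardCoeff z j =
      bitSign (z ⬝ᵥ (i + j)) / 2 ^ n := by
    intro z
    rw [hadamardCoeff_comm i z, hadamardCoeff, hadamardCoeff, div_mul_div_comm, ← bitSign_add,
      ← dotProduct_add, Real.mul_self_sqrt hN.le]
  simp only [h, ← Finset.sum_div, sum_bitSign_dotProduct, bitString_add_eq_zero_iff]
  split_ifs
  · exact div_self hN.ne'
  · exact zero_div _

/-! ### Simon sampling -/

/-- The amplitude of `(z, b)` after preparing the uniform superposition of all indices, querying
`x`, and applying the Hadamard transform to the index register. -/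
noncomputable def simonAmplitude {n : ℕ} (x : BitString n → ZMod (2 ^ n))
    (p : BitString n × ZMod (2 ^ n)) : ℝ :=
  ∑ i, hadamardCoeff p.1 i * (1 / √((2 : ℝ) ^ n) * if p.2 = x i then 1 else 0)

/-- Expand the square into pairs `(i, j)`: summing over the answer forces `x i = x j`, and summing
the characters over `z` forces `j = i + s`. -/
theorem sum_simonAmplitude_sq_mul {n : ℕ} (x : BitString n → ZMod (2 ^ n)) (s : BitString n) :
    ∑ p, simonAmplitude x p ^ 2 * bitSign (p.1 ⬝ᵥ s) =
      (Finset.card {i | x i = x (i + s)} : ℝ) / 2 ^ n := by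
  have hN : (0 : ℝ) < 2 ^ n := by positivity
  have h1 : ∀ p : BitString n × ZMod (2 ^ n), simonAmplitude x p ^ 2 * bitSign (p.1 ⬝ᵥ s) =
      ∑ i, ∑ j, (1 / 2 ^ n) ^ 2 * ((if p.2 = x i then 1 else 0) * (if p.2 = x j then 1 else 0) *
        bitSign (p.1 ⬝ᵥ (i + j + s))) := by
    intro p
    have ha : simonAmplitude x p =
        ∑ i, (1 / 2 ^ n) * (bitSign (p.1 ⬝ᵥ i) * if p.2 = x i then 1 else 0) := by
      refine Finset.sum_congr rfl fun i _ => ?_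
      rw [hadamardCoeff]
      nth_rewrite 3 [← Real.mul_self_sqrt hN.le]
      field_simp
    rw [ha, sq, Finset.sum_mul_sum, Finset.sum_mul]
    refine Finset.sum_congr rfl fun i _ => ?_
    rw [Finset.sum_mul]
    refine Finset.sum_congr rfl fun j _ => ?_
    rw [dotProduct_add, dotProduct_add, bitSign_add, bitSign_add]
    ring
  have h2 : ∀ i j : BitString n, ∑ p : BitString n × ZMod (2 ^ n),
      (1 / (2 : ℝ) ^ n) ^ 2 * ((if p.2 = x i then 1 else 0) * (if p.2 = x j then 1 else 0) *
        bitSign (p.1 ⬝ᵥ (i + j + s))) =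
      if j = i + s then (if x i = x j then 1 / 2 ^ n else 0) else 0 := by
    intro i j
    have hij : i + j + s = 0 ↔ j = i + s := by
      rw [add_right_comm, bitString_add_eq_zero_iff, eq_comm]
    rw [← Finset.mul_sum, Fintype.sum_prod_type]
    simp only [← Finset.sum_mul, mul_ite, mul_one, mul_zero, Finset.sum_ite_eq',
      Finset.mem_univ, if_true]
    by_cases h : x i = x j
    · simp only [if_pos h, if_pos h.symm, one_mul, sum_bitSign_dotProduct, hij]
      split_ifs
      · field_simp
      · simp
    · simp [h, Ne.symm h]
  simp only [h1]
  rw [Finset.sum_comm]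
  simp only [Finset.sum_comm (s := (Finset.univ : Finset (BitString n × ZMod (2 ^ n)))), h2,
    Finset.sum_ite_eq', Finset.mem_univ, if_true]
  rw [← Finset.sum_filter, Finset.sum_const, nsmul_eq_mul, mul_one_div]

theorem sum_simonAmplitude_sq {n : ℕ} (x : BitString n → ZMod (2 ^ n)) :
    ∑ p, simonAmplitude x p ^ 2 = 1 := by
  have h := sum_simonAmplitude_sq_mul x 0
  simpa [bitSign_zero] using h

/-- The probability that a Simon sample is orthogonal to `s`. -/
theorem sum_simonAmplitude_sq_orthogonal {n : ℕ} (x : BitString n → ZMod (2 ^ n))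
    (s : BitString n) :
    ∑ p with p.1 ⬝ᵥ s = 0, simonAmplitude x p ^ 2 =
      (1 + (Finset.card {i | x i = x (i + s)} : ℝ) / 2 ^ n) / 2 := by
  rw [← sum_simonAmplitude_sq_mul, ← sum_simonAmplitude_sq x, ← Finset.sum_add_distrib,
    Finset.sum_div, Finset.sum_filter]
  refine Finset.sum_congr rfl fun p _ => ?_
  split_ifs with h
  · rw [h, bitSign_zero]
    ring
  · rw [bitSign_of_ne h]
    ring

/-- Folding `x` alters only one index of each pair `{i, i + s}` on which `x` is not constant. Being
far makes the altered set `D` have size at least `N/4`; with its disjoint translate it gives at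
least `N/2` indices where `x i ≠ x (i + s)`. -/
theorem card_eq_shift_le_of_isFar {n : ℕ} {x : BitString n → ZMod (2 ^ n)}
    (hx : IsFar (1 / 4) (simonProperty n) x) {s : BitString n} (hs : s ≠ 0) :
    (Finset.card {i | x i = x (i + s)} : ℝ) / 2 ^ n ≤ 1 / 2 := by
  have hN : (0 : ℝ) < 2 ^ n := by positivity
  obtain ⟨k, hk⟩ := exists_coord_ne_zero hs
  have h := hx _ (comp_foldAlong_mem_simonProperty hk x)
  rw [normHammingDist, card_bitString, le_div_iff₀ (by positivity)] at h
  set E : Finset (BitString n) := {i | x i = x (i + s)}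
  set F : Finset (BitString n) := {i | x i ≠ x (i + s)}
  set D : Finset (BitString n) := {i | x i ≠ (x ∘ foldAlong s k) i} with hD
  have hd : hammingDist x (x ∘ foldAlong s k) = D.card := rfl
  have hEF : E.card + F.card = 2 ^ n := by
    rw [← card_bitString n]
    exact Finset.card_filter_add_card_filter_not _
  have hmem : ∀ i ∈ D, i k ≠ 0 ∧ x i ≠ x (i + s) := by
    intro i hi
    replace hi := (Finset.mem_filter.1 hi).2
    simp only [Function.comp_apply, foldAlong] at hi
    split_ifs at hi with h0
    · exact absurd rfl hi
    · exact ⟨h0, hi⟩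
  have h2 : ∀ a b : ZMod 2, a ≠ 0 → b ≠ 0 → ¬ a + b ≠ 0 := by decide
  have hdisj : Disjoint D (D.map (addRightEmbedding s)) := by
    rw [Finset.disjoint_left]
    intro i hi hi'
    obtain ⟨j, hj, rfl⟩ := Finset.mem_map.1 hi'
    exact h2 _ _ (hmem j hj).1 hk (hmem _ hi).1
  have hsub : D ∪ D.map (addRightEmbedding s) ⊆ F := by
    intro i hi
    rcases Finset.mem_union.1 hi with hi | hi
    · simpa [F] using (hmem i hi).2
    · obtain ⟨j, hj, rfl⟩ := Finset.mem_map.1 hi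
      simp only [F, Finset.mem_filter, Finset.mem_univ, true_and, addRightEmbedding_apply,
        bitString_add_add_self]
      exact (hmem j hj).2.symm
  have hcard := Finset.card_le_card hsub
  rw [Finset.card_union_of_disjoint hdisj, Finset.card_map] at hcard
  rw [hd] at h
  have h3 : (E.card : ℝ) + F.card = 2 ^ n := by exact_mod_cast hEF
  have h4 : (D.card : ℝ) + D.card ≤ F.card := by exact_mod_cast hcard
  push_cast at h
  rw [div_le_iff₀ hN]
  linarith

/-- The event that the samples in `g` are all orthogonal to a common nonzero `s`. -/
def HasCommonPeriod {n K : ℕ} (g : Fin K → BitString n × ZMod (2 ^ n)) : Prop :=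
  ∃ s : BitString n, s ≠ 0 ∧ ∀ k, (g k).1 ⬝ᵥ s = 0

/-- Independence of the samples: the `K`-th power of a sum expands into a sum of products. -/
theorem sum_prod_orthogonal {n K : ℕ} (x : BitString n → ZMod (2 ^ n)) (s : BitString n) :
    ∑ g : Fin K → BitString n × ZMod (2 ^ n) with ∀ k, (g k).1 ⬝ᵥ s = 0,
        ∏ k, simonAmplitude x (g k) ^ 2 =
      ((1 + (Finset.card {i | x i = x (i + s)} : ℝ) / 2 ^ n) / 2) ^ K := by
  rw [← sum_simonAmplitude_sq_orthogonal, Finset.sum_pow']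
  refine Finset.sum_congr ?_ fun _ _ => rfl
  ext g
  simp

open Classical in
theorem sum_hasCommonPeriod_of_mem {n K : ℕ} {x : BitString n → ZMod (2 ^ n)}
    (hx : x ∈ simonProperty n) :
    1 ≤ ∑ g : Fin K → BitString n × ZMod (2 ^ n) with HasCommonPeriod g,
      ∏ k, simonAmplitude x (g k) ^ 2 := by
  obtain ⟨s, hs, h⟩ := hx
  have h1 := sum_prod_orthogonal (K := K) x s
  have h2 : Finset.card {i | x i = x (i + s)} = 2 ^ n := by
    rw [Finset.filter_true_of_mem fun i _ => h i _ rfl, Finset.card_univ, card_bitString]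
  rw [h2] at h1
  have h3 : ((1 + ((2 ^ n : ℕ) : ℝ) / 2 ^ n) / 2) ^ K = 1 := by
    push_cast
    rw [div_self (by positivity)]
    norm_num
  rw [← h3, ← h1]
  refine Finset.sum_le_sum_of_subset_of_nonneg ?_ fun _ _ _ => by positivity
  intro g hg
  simp only [Finset.mem_filter, Finset.mem_univ, true_and] at hg ⊢
  exact ⟨s, hs, hg⟩

open Classical in
theorem sum_hasCommonPeriod_le_of_isFar {n K : ℕ} {x : BitString n → ZMod (2 ^ n)}
    (hx : IsFar (1 / 4) (simonProperty n) x) :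
    ∑ g : Fin K → BitString n × ZMod (2 ^ n) with HasCommonPeriod g,
      ∏ k, simonAmplitude x (g k) ^ 2 ≤ 2 ^ n * (3 / 4) ^ K := by
  calc _ ≤ ∑ s : BitString n with s ≠ 0,
          ∑ g : Fin K → BitString n × ZMod (2 ^ n) with ∀ k, (g k).1 ⬝ᵥ s = 0,
            ∏ k, simonAmplitude x (g k) ^ 2 := by
        simp only [Finset.sum_filter (p := fun g : Fin K → BitString n × ZMod (2 ^ n) => _)]
        rw [Finset.sum_comm]
        refine Finset.sum_le_sum fun g _ => ?_
        split_ifs with hg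
        · obtain ⟨s, hs, h⟩ := hg
          refine le_trans (le_of_eq (if_pos h).symm) (Finset.single_le_sum
            (f := fun s => if ∀ k, (g k).1 ⬝ᵥ s = 0 then ∏ k, simonAmplitude x (g k) ^ 2 else 0)
            (fun s _ => ?_) (by simpa using hs))
          split_ifs <;> positivity
        · exact Finset.sum_nonneg fun s _ => by split_ifs <;> positivity
    _ ≤ ∑ s : BitString n with s ≠ 0, (3 / 4 : ℝ) ^ K := by
        refine Finset.sum_le_sum fun s hs => ?_
        rw [sum_prod_orthogonal]
        have := card_eq_shift_le_of_isFar hx (Finset.mem_filter.1 hs).2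
        refine pow_le_pow_left₀ (by positivity) ?_ K
        linarith
    _ ≤ ∑ s : BitString n, (3 / 4 : ℝ) ^ K :=
        Finset.sum_le_sum_of_subset_of_nonneg (Finset.filter_subset _ _) fun _ _ _ => by positivity
    _ = _ := by
        rw [Finset.sum_const, nsmul_eq_mul, Finset.card_univ, card_bitString]
        push_cast
        rfl

/-! ### The quantum tester -/

theorem Equiv.Perm.permMatrix_mem_unitaryGroup {ι : Type} [Fintype ι] [DecidableEq ι]
    (σ : Equiv.Perm ι) : σ.permMatrix ℂ ∈ Matrix.unitaryGroup ι ℂ := by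
  rw [Matrix.mem_unitaryGroup_iff, Matrix.star_eq_conjTranspose, Matrix.conjTranspose_permMatrix,
    ← Matrix.permMatrix_mul, inv_mul_cancel, Matrix.permMatrix_one]

/-- The Hadamard transform `|i⟩ ↦ ∑ j, (-1)^(i·j) |j⟩ / √N`. -/
noncomputable def hadamardMatrix (n : ℕ) : Matrix (BitString n) (BitString n) ℂ :=
  Matrix.of fun i j => (hadamardCoeff i j : ℂ)

theorem hadamardMatrix_mem_unitaryGroup (n : ℕ) :
    hadamardMatrix n ∈ Matrix.unitaryGroup (BitString n) ℂ := by
  rw [Matrix.mem_unitaryGroup_iff]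
  ext i j
  have h := sum_hadamardCoeff_mul i j
  simp only [Matrix.mul_apply, Matrix.star_apply, hadamardMatrix, Matrix.of_apply,
    Complex.star_def, Complex.conj_ofReal, Matrix.one_apply, hadamardCoeff_comm j]
  rw [← Complex.ofReal_one, ← Complex.ofReal_zero, ← apply_ite, ← h]
  push_cast
  rfl

open scoped Kronecker in
/-- The Hadamard transform on the index register. -/
noncomputable def hadamardIndex (n w : ℕ) : Matrix.unitaryGroup (QBasis (BitString n) (2 ^ n) w) ℂ :=
  ⟨hadamardMatrix n ⊗ₖ (1 : Matrix (ZMod (2 ^ n) × (Fin w → Bool)) _ ℂ),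
    Matrix.kronecker_mem_unitary (hadamardMatrix_mem_unitaryGroup n) (one_mem _)⟩

theorem hadamardIndex_mulVec {n w : ℕ} (ψ : QBasis (BitString n) (2 ^ n) w → ℂ)
    (i : BitString n) (r : ZMod (2 ^ n) × (Fin w → Bool)) :
    (hadamardIndex n w).val.mulVec ψ (i, r) = ∑ j, (hadamardCoeff i j : ℂ) * ψ (j, r) := by
  simp only [hadamardIndex, Matrix.mulVec, dotProduct, Fintype.sum_prod_type (α₁ := BitString n),
    Matrix.kroneckerMap_apply, Matrix.one_apply, hadamardMatrix, Matrix.of_apply, mul_ite, mul_one,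
    mul_zero, ite_mul, zero_mul, Finset.sum_ite_eq, Finset.mem_univ, if_true]

/-- An identification of the states of `w` qubits with the contents of `K` slots, each holding an
index and an answer. -/
abbrev SlotEncoding (n K w : ℕ) : Type :=
  (Fin w → Bool) ≃ (Fin K → BitString n × ZMod (2 ^ n))

theorem exists_slotEncoding (n K : ℕ) :
    ∃ e : SlotEncoding n K (K * (n + n)), e (fun _ => false) = 0 := by
  have hcard : Fintype.card (Fin (K * (n + n)) → Bool) =
      Fintype.card (Fin K → BitString n × ZMod (2 ^ n)) := by
    simp [ZMod.card, ← pow_add, ← pow_mul, mul_comm]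
  let e₀ : SlotEncoding n K (K * (n + n)) := Fintype.equivOfCardEq hcard
  -- Any bijection serves after a swap making the initial workspace encode empty slots.
  exact ⟨e₀.trans (Equiv.swap (e₀ fun _ => false) 0), by simp⟩

/-- Exchange the index and answer registers with the slot `t`. -/
def swapSlot {n K w : ℕ} (e : SlotEncoding n K w) (t : Fin K) :
    Equiv.Perm (QBasis (BitString n) (2 ^ n) w) :=
  Function.Involutive.toPerm
    (fun z => ((e z.2.2 t).1, (e z.2.2 t).2,
      e.symm (Function.update (e z.2.2) t (z.1, z.2.1)))) (by
      rintro ⟨i, b, v⟩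
      simp)

theorem swapSlot_apply {n K w : ℕ} (e : SlotEncoding n K w) (t : Fin K)
    (z : QBasis (BitString n) (2 ^ n) w) :
    swapSlot e t z = ((e z.2.2 t).1, (e z.2.2 t).2,
      e.symm (Function.update (e z.2.2) t (z.1, z.2.1))) :=
  rfl

/-- Exchange the index and answer registers with the slot `t`, as a unitary. -/
noncomputable def swapSlotUnitary {n K w : ℕ} (e : SlotEncoding n K w) (t : Fin K) :
    Matrix.unitaryGroup (QBasis (BitString n) (2 ^ n) w) ℂ :=
  ⟨(swapSlot e t).permMatrix ℂ, Equiv.Perm.permMatrix_mem_unitaryGroup _⟩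

open Classical in
/-- Repeated Simon sampling: each of the `K` samples is stored in its own slot, and the tester
accepts if all samples are orthogonal to a common nonzero string. -/
noncomputable def simonTester {n K w : ℕ} (e : SlotEncoding n K w) :
    QuantumQueryAlgorithm (BitString n) (2 ^ n) where
  queries := K
  w := w
  U
    | 0 => hadamardIndex n w
    | t + 1 => if h : t < K then
        hadamardIndex n w * swapSlotUnitary e ⟨t, h⟩ * hadamardIndex n w else 1
  output z := decide (HasCommonPeriod (e z.2.2))

/-- The state of `simonTester e` on input `x` after `t` queries. -/
noncomputable def simonState {n K w : ℕ} (e : SlotEncoding n K w) (x : BitString n → ZMod (2 ^ n))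
    (t : ℕ) : QBasis (BitString n) (2 ^ n) w → ℂ :=
  (simonTester e).state x t

theorem simonState_zero {n K w : ℕ} (e : SlotEncoding n K w) (x : BitString n → ZMod (2 ^ n)) :
    simonState e x 0 = (hadamardIndex n w).val.mulVec (Pi.single (0, 0, fun _ => false) 1) :=
  rfl

theorem simonState_succ {n K w : ℕ} (e : SlotEncoding n K w) (x : BitString n → ZMod (2 ^ n))
    {t : ℕ} (ht : t < K) :
    simonState e x (t + 1) = (hadamardIndex n w).val.mulVec
      ((swapSlotUnitary e ⟨t, ht⟩).val.mulVec
        ((hadamardIndex n w).val.mulVec (quantumQuery x (simonState e x t)))) := by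
  have hU : simonState e x (t + 1) =
      (if h : t < K then hadamardIndex n w * swapSlotUnitary e ⟨t, h⟩ * hadamardIndex n w
        else 1).val.mulVec (quantumQuery x (simonState e x t)) := rfl
  rw [hU, dif_pos ht, Submonoid.coe_mul, Submonoid.coe_mul, ← Matrix.mulVec_mulVec,
    ← Matrix.mulVec_mulVec]

/-- The amplitude of the slot contents `g` after `t` rounds. -/
noncomputable def slotAmplitude {n K : ℕ} (x : BitString n → ZMod (2 ^ n)) (t : ℕ)
    (g : Fin K → BitString n × ZMod (2 ^ n)) : ℝ :=
  ∏ k, if k.val < t then simonAmplitude x (g k) else if g k = 0 then 1 else 0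

theorem slotAmplitude_zero {n K : ℕ} (x : BitString n → ZMod (2 ^ n))
    (g : Fin K → BitString n × ZMod (2 ^ n)) :
    slotAmplitude x 0 g = if g = 0 then 1 else 0 := by
  simp [slotAmplitude, Finset.prod_ite_zero, funext_iff]

theorem slotAmplitude_top {n K : ℕ} (x : BitString n → ZMod (2 ^ n))
    (g : Fin K → BitString n × ZMod (2 ^ n)) :
    slotAmplitude x K g = ∏ k, simonAmplitude x (g k) := by
  simp [slotAmplitude]

/-- Effect of the swap in round `t`: the fresh sample enters slot `t`, and that slot's zero content
resets the registers. -/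
theorem simonAmplitude_mul_slotAmplitude_update {n K : ℕ} (x : BitString n → ZMod (2 ^ n))
    (t : Fin K) (g : Fin K → BitString n × ZMod (2 ^ n)) (p : BitString n × ZMod (2 ^ n)) :
    simonAmplitude x (g t) * slotAmplitude x t (Function.update g t p) =
      (if p = 0 then 1 else 0) * slotAmplitude x (t + 1) g := by
  rw [slotAmplitude, slotAmplitude, ← Finset.mul_prod_erase _ _ (Finset.mem_univ t),
    ← Finset.mul_prod_erase _ _ (Finset.mem_univ t), mul_left_comm]
  congr 1
  · simp
  · rw [if_pos (Nat.lt_succ_self _)]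
    congr 1
    refine Finset.prod_congr rfl fun k hk => ?_
    have hk' : k ≠ t := Finset.ne_of_mem_erase hk
    have h : k.val < t.val + 1 ↔ k.val < t.val := by
      have := Fin.val_ne_of_ne hk'
      omega
    simp only [h, Function.update_of_ne hk']

/-- Between rounds the index register is uniform, the answer register is zero, and the slots carry a
product state: ready for the next query. -/
theorem simonState_apply {n K w : ℕ} (e : SlotEncoding n K w) (he : e (fun _ => false) = 0)
    (x : BitString n → ZMod (2 ^ n)) (t : ℕ) (ht : t ≤ K) (i : BitString n) (b : ZMod (2 ^ n))
    (v : Fin w → Bool) :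
    simonState e x t (i, b, v) =
      ((1 / √((2 : ℝ) ^ n) * (if b = 0 then 1 else 0) * slotAmplitude x t (e v) : ℝ) : ℂ) := by
  induction t generalizing i b v with
  | zero =>
    have hv : e v = 0 ↔ v = fun _ => false := by rw [← he, e.apply_eq_iff_eq]
    rw [simonState_zero, hadamardIndex_mulVec, slotAmplitude_zero, Finset.sum_eq_single 0]
    · simp only [Pi.single_apply, Prod.mk.injEq, true_and, hadamardCoeff_zero_right, hv]
      by_cases h1 : b = 0 <;> by_cases h2 : v = fun _ => false <;> simp [h1, h2]
    · intro j _ hj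
      simp [hj]
    · simp
  | succ t ih =>
    have htK : t < K := ht
    have h1 : ∀ i b v, (hadamardIndex n w).val.mulVec
        (quantumQuery x (simonState e x t)) (i, b, v) =
        ((simonAmplitude x (i, b) * slotAmplitude x t (e v) : ℝ) : ℂ) := by
      intro i b v
      rw [hadamardIndex_mulVec, simonAmplitude, Finset.sum_mul, Complex.ofReal_sum]
      refine Finset.sum_congr rfl fun j _ => ?_
      have hq : quantumQuery x (simonState e x t) (j, b, v) =
        simonState e x t (j, b - x j, v) := rfl
      rw [hq, ih (by omega)]
      simp only [sub_eq_zero]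
      push_cast
      ring
    rw [simonState_succ e x htK, hadamardIndex_mulVec]
    have h2 : ∀ j, (swapSlotUnitary e ⟨t, htK⟩).val.mulVec ((hadamardIndex n w).val.mulVec
        (quantumQuery x (simonState e x t))) (j, b, v) =
        (((if (j, b) = 0 then 1 else 0) * slotAmplitude x (t + 1) (e v) : ℝ) : ℂ) := by
      intro j
      rw [swapSlotUnitary, Matrix.permMatrix_mulVec, Function.comp_apply, swapSlot_apply, h1,
        Equiv.apply_symm_apply]
      exact congrArg _ (simonAmplitude_mul_slotAmplitude_update x ⟨t, htK⟩ (e v) (j, b))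
    rw [Finset.sum_eq_single 0]
    · rw [h2, hadamardCoeff_zero_right]
      simp only [Prod.mk_eq_zero, true_and]
      push_cast
      ring
    · intro j _ hj
      rw [h2]
      simp [Prod.mk_eq_zero, hj]
    · simp

open Classical in
theorem simonTester_outputProb {n K w : ℕ} (e : SlotEncoding n K w) (he : e (fun _ => false) = 0)
    (x : BitString n → ZMod (2 ^ n)) (a : Bool) :
    (simonTester e).outputProb x a =
      ∑ g : Fin K → BitString n × ZMod (2 ^ n) with decide (HasCommonPeriod g) = a,
        ∏ k, simonAmplitude x (g k) ^ 2 := by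
  have hN : (0 : ℝ) < 2 ^ n := by positivity
  have h1 : ∀ z : QBasis (BitString n) (2 ^ n) w, ‖simonState e x K z‖ ^ 2 =
      1 / 2 ^ n * ((if z.2.1 = 0 then 1 else 0) * ∏ k, simonAmplitude x (e z.2.2 k) ^ 2) := by
    rintro ⟨i, b, v⟩
    rw [simonState_apply e he x K le_rfl, Complex.norm_real, Real.norm_eq_abs, sq_abs, mul_pow,
      mul_pow, div_pow, Real.sq_sqrt hN.le, slotAmplitude_top, Finset.prod_pow]
    simp
  have h2 : (simonTester e).outputProb x a =
      ∑ z : QBasis (BitString n) (2 ^ n) w with decide (HasCommonPeriod (e z.2.2)) = a,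
        ‖simonState e x K z‖ ^ 2 := rfl
  set F : (Fin w → Bool) → ℝ := fun v =>
    if decide (HasCommonPeriod (e v)) = a then ∏ k, simonAmplitude x (e v k) ^ 2 else 0
  set G : ZMod (2 ^ n) → ℝ := fun b => if b = 0 then 1 else 0
  have h3 : ∀ z : QBasis (BitString n) (2 ^ n) w,
      (if decide (HasCommonPeriod (e z.2.2)) = a then ‖simonState e x K z‖ ^ 2 else 0) =
        1 / 2 ^ n * (G z.2.1 * F z.2.2) := by
    intro z
    rw [h1]
    by_cases h : decide (HasCommonPeriod (e z.2.2)) = a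
    · simp only [F, G, if_pos h]
    · simp only [F, if_neg h, mul_zero]
  have h4 : ∑ b, G b = 1 := by simp [G]
  rw [h2, Finset.sum_filter, Finset.sum_filter, ← Equiv.sum_comp e,
    Finset.sum_congr rfl fun z _ => h3 z, ← Finset.mul_sum]
  -- The leftover uniform index register contributes `N` equal terms, cancelling `1 / N`.
  simp only [Fintype.sum_prod_type, ← Finset.mul_sum, ← Finset.sum_mul, h4, one_mul, Finset.sum_const, Finset.card_univ, card_bitString,
    nsmul_eq_mul]
  push_cast
  rw [← mul_assoc, one_div, inv_mul_cancel₀ hN.ne', one_mul]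

theorem simonTester_outputProb_true_add_false {n K w : ℕ} (e : SlotEncoding n K w)
    (he : e (fun _ => false) = 0) (x : BitString n → ZMod (2 ^ n)) :
    (simonTester e).outputProb x true + (simonTester e).outputProb x false = 1 := by
  classical
  have h : ∑ g : Fin K → BitString n × ZMod (2 ^ n), ∏ k, simonAmplitude x (g k) ^ 2 = 1 := by
    have := Finset.sum_pow' Finset.univ (fun p => simonAmplitude x p ^ 2) K
    rw [sum_simonAmplitude_sq, one_pow, Fintype.piFinset_univ] at this
    exact this.symm
  rw [simonTester_outputProb e he, simonTester_outputProb e he, ← h]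
  simp only [decide_eq_true_eq, decide_eq_false_iff_not]
  exact Finset.sum_filter_add_sum_filter_not _ _ _

theorem simonTester_isPropertyTester {n w : ℕ} (hn : 1 ≤ n) (e : SlotEncoding n (7 * n) w)
    (he : e (fun _ => false) = 0) :
    IsPropertyTester (1 / 4) (simonProperty n) (simonTester e).outputProb := by
  classical
  constructor
  · intro x hx
    rw [simonTester_outputProb e he]
    simp only [decide_eq_true_eq]
    have := sum_hasCommonPeriod_of_mem (K := 7 * n) hx
    linarith
  · intro x hx
    have h1 := simonTester_outputProb_true_add_false e he x
    have h2 : (simonTester e).outputProb x true ≤ 2 ^ n * (3 / 4) ^ (7 * n) := by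
      rw [simonTester_outputProb e he]
      simp only [decide_eq_true_eq]
      exact sum_hasCommonPeriod_le_of_isFar hx
    -- The constant 7 comes from here: `2·(3/4)^7 < 1/3`, whereas exponent 6 is too small.
    have h3 : (2 : ℝ) ^ n * (3 / 4) ^ (7 * n) ≤ 1 / 3 := by
      rw [pow_mul, ← mul_pow]
      refine (pow_le_of_le_one (by norm_num) (by norm_num) (by omega)).trans (by norm_num)
    linarith

theorem mainTheorem2 :
    (∃ C : ℝ, 0 < C ∧ ∀ n : ℕ, 1 ≤ n →
      ∃ Q : QuantumQueryAlgorithm (BitString n) (2 ^ n),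
        (Q.queries : ℝ) ≤ C * Real.logb 2 ((2 : ℝ) ^ n) ∧
        IsPropertyTester (1 / 4) (simonProperty n) Q.outputProb) ∧
    (∃ c : ℝ, 0 < c ∧ ∀ n : ℕ, 1 ≤ n →
      ∀ R : ClassicalQueryAlgorithm (BitString n) (ZMod (2 ^ n)),
        IsPropertyTester (1 / 4) (simonProperty n) R.outputProb →
        c * √((2 : ℝ) ^ n) ≤ (R.queries : ℝ)) := by
  refine ⟨⟨7, by norm_num, fun n hn => ?_⟩, 1 / 3, by norm_num,
    fun n hn R hR => sqrt_le_queries_of_isPropertyTester hn R hR⟩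
  obtain ⟨e, he⟩ := exists_slotEncoding n (7 * n)
  refine ⟨simonTester e, ?_, simonTester_isPropertyTester hn e he⟩
  have hq : (simonTester e).queries = 7 * n := rfl
  rw [hq, Real.logb_pow, Real.logb_self_eq_one one_lt_two]
  push_cast
  linarith
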